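/- Let $H$ be a complex Hilbert space and let $\mathcal N$ be a complete nest on $H$, that is, a totally ordered complete sublattice, containing $0$ and $I$, of the lattice of orthogonal projections of $H$. For $P\in\mathcal N$ put $P^\perp=I-P$ and $P_-=\bigvee\{Q\in\mathcal N: Q<P\}$. Let $\mathcal T(\mathcal N)=\{T\in\mathcal B(H): P^\perp TP=0 \text{ for all } P\in\mathcal N\}$ be the nest algebra and $\mathcal D(\mathcal N)=\mathcal T(\mathcal N)\cap\mathcal T(\mathcal N)^*$ its diagonal. Let $\mathcal L\subseteq\mathcal B(H)$ be a complex subspace that is closed in the weak operator topology and is a Lie $\mathcal T(\mathcal N)$-module, i.e. $TS-ST\in\mathcal L$ for all $T\in\mathcal L$ and $S\in\mathcal T(\mathcal N)$. Let $$\mathcal K(\mathcal L)=\mathcal K_V+\mathcal K_L+\mathcal K_D+\mathcal K_\Delta ,$$ where, with $\overline{\mathrm{span}}^w$ denoting the closure of the linear span in the weak operator topology, $$\mathcal K_V=\overline{\mathrm{span}}^w\{PTP^\perp: P\in\mathcal N,\,T\in\mathcal L\},\qquad \mathcal K_L=\overline{\mathrm{span}}^w\{P^\perp TP: P\in\mathcal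 N,\,T\in\mathcal L\},$$ $$\mathcal K_D=\overline{\mathrm{span}}^w\{PSP^\perp TP: P\in\mathcal N,\,T\in\mathcal L,\,S\in\mathcal T(\mathcal N)\},\qquad \mathcal K_\Delta=\overline{\mathrm{span}}^w\{P^\perp TPSP^\perp: P\in\mathcal N,\,T\in\mathcal L,\,S\in\mathcal T(\mathcal N)\}.$$ For $P\in\mathcal N$ let $$\phi(P)=\bigvee\{Q\in\mathcal N: Q\,\mathcal B(H)R^\perp\subseteq\mathcal K(\mathcal L)\text{ for some } R\in\mathcal N \text{ with } R<P\},$$ and let $\mathcal D_{\mathcal K(\mathcal L)}$ be the algebra of all $T\in\mathcal D(\mathcal N)$ such that for every $P\in\mathcal N$ with $\phi(P)<P_-$ there is $\lambda_P\in\mathbb C$ with $T(P-\phi(P))=\lambda_P(P-\phi(P))$. Then $$\mathcal L\subseteq\mathcal K(\mathcal L)+\mathcal D_{\mathcal K(\mathcal L)} .$$ The same inclusion holds if, in the definition of $\mathcal D_{\mathcal K(\mathcal L)}$, $\phi$ is replaced by any order preserving map $\phi:\mathcal N\to\mathcal N$ that satisfies $\phi(\bigvee\mathcal X)=\bigvee\phi(\mathcal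 X)$ for every $\mathcal X\subseteq\mathcal N$ and $\mathcal K(\mathcal L)=\{T\in\mathcal B(H):\phi(P)^\perp TP=0\text{ for all }P\in\mathcal N\}$. -/

import Mathlib

/-- The orthogonal projection onto a closed subspace, as an element of `B(H)`. -/
noncomputable def ClosedSubmodule.proj {H : Type*} [NormedAddCommGroup H] [InnerProductSpace ℂ H]
    [CompleteSpace H] (P : ClosedSubmodule ℂ H) : H →L[ℂ] H :=
  P.toSubmodule.starProjection

/-- The complementary projection `P^⊥ = I - P`. -/
noncomputable def ClosedSubmodule.coproj {H : Type*} [NormedAddCommGroup H]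
    [InnerProductSpace ℂ H] [CompleteSpace H] (P : ClosedSubmodule ℂ H) : H →L[ℂ] H :=
  1 - P.proj

/-- A subspace of `B(H)` is weakly closed if it is closed in the weak operator topology. -/
def IsWeaklyClosed {H : Type*} [NormedAddCommGroup H] [InnerProductSpace ℂ H]
    (M : Submodule ℂ (H →L[ℂ] H)) : Prop :=
  IsClosed {A : H →WOT[ℂ] H | A.toCLM ∈ M}

/-- The closure, in the weak operator topology, of the linear span of a set of operators. -/
noncomputable def wotSpan {H : Type*} [NormedAddCommGroup H] [InnerProductSpace ℂ H]
    (X : Set (H →L[ℂ] H)) : Submodule ℂ (H →L[ℂ] H) :=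
  (((Submodule.span ℂ X).comap
    (ContinuousLinearMapWOT.linearEquiv (σ := RingHom.id ℂ) (E := H) (F := H) ℂ).toLinearMap
    ).topologicalClosure).comap
    (ContinuousLinearMapWOT.linearEquiv (σ := RingHom.id ℂ) (E := H) (F := H) ℂ).symm.toLinearMap

/-- A complete nest on `H`: a totally ordered complete sublattice, containing `0` and `I`, of the
lattice of orthogonal projections of `H`. Projections are identified with their ranges, so that
the lattice of projections is the lattice of closed subspaces. -/
structure CompleteNest (H : Type*) [NormedAddCommGroup H] [InnerProductSpace ℂ H] where
  carrier : Set (ClosedSubmodule ℂ H)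
  bot_mem : ⊥ ∈ carrier
  top_mem : ⊤ ∈ carrier
  total : ∀ P ∈ carrier, ∀ Q ∈ carrier, P ≤ Q ∨ Q ≤ P
  sSup_mem : ∀ X ⊆ carrier, sSup X ∈ carrier
  sInf_mem : ∀ X ⊆ carrier, sInf X ∈ carrier

namespace CompleteNest

variable {H : Type*} [NormedAddCommGroup H] [InnerProductSpace ℂ H]

instance : Membership (ClosedSubmodule ℂ H) (CompleteNest H) :=
  ⟨fun N P => P ∈ N.carrier⟩

/-- `P_- = ⋁ {Q ∈ N : Q < P}`. -/
noncomputable def pred (N : CompleteNest H) (P : ClosedSubmodule ℂ H) : ClosedSubmodule ℂ H :=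
  sSup {Q | Q ∈ N ∧ Q < P}

/-- The nest algebra: all operators leaving every element of the nest invariant. -/
def nestAlgebra (N : CompleteNest H) : Subalgebra ℂ (H →L[ℂ] H) where
  carrier := {T | ∀ P ∈ N, ∀ x ∈ P, T x ∈ P}
  mul_mem' := fun {S T} hS hT P hP x hx => hS P hP _ (hT P hP x hx)
  add_mem' := fun {S T} hS hT P hP x hx => add_mem (hS P hP x hx) (hT P hP x hx)
  algebraMap_mem' := fun c P _ x hx => by
    rw [Algebra.algebraMap_eq_smul_one]
    exact P.toSubmodule.smul_mem c hx

/-- `M` is a Lie module over the nest algebra: `[M, T(N)] ⊆ M`. -/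
def IsLieModule (N : CompleteNest H) (M : Submodule ℂ (H →L[ℂ] H)) : Prop :=
  ∀ T ∈ M, ∀ S ∈ N.nestAlgebra, T * S - S * T ∈ M

variable [CompleteSpace H]

/-- The diagonal `D(N) = T(N) ∩ T(N)^*`. -/
noncomputable def diagonal (N : CompleteNest H) : Subalgebra ℂ (H →L[ℂ] H) where
  carrier := {T | T ∈ N.nestAlgebra ∧ star T ∈ N.nestAlgebra}
  mul_mem' := fun {S T} hS hT =>
    ⟨mul_mem hS.1 hT.1, by rw [star_mul]; exact mul_mem hT.2 hS.2⟩
  add_mem' := fun {S T} hS hT =>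
    ⟨add_mem hS.1 hT.1, by rw [star_add]; exact add_mem hS.2 hT.2⟩
  algebraMap_mem' := fun c =>
    ⟨algebraMap_mem _ c, by rw [← algebraMap_star_comm]; exact algebraMap_mem _ _⟩

/-- The weakly closed span of the operators `P T P^⊥`. -/
noncomputable def KV (N : CompleteNest H) (L : Submodule ℂ (H →L[ℂ] H)) :
    Submodule ℂ (H →L[ℂ] H) :=
  wotSpan {A | ∃ P ∈ N, ∃ T ∈ L, A = P.proj * T * P.coproj}

/-- The weakly closed span of the operators `P^⊥ T P`. -/
noncomputable def KL (N : CompleteNest H) (L : Submodule ℂ (H →L[ℂ] H)) :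
    Submodule ℂ (H →L[ℂ] H) :=
  wotSpan {A | ∃ P ∈ N, ∃ T ∈ L, A = P.coproj * T * P.proj}

/-- The weakly closed span of the operators `P S P^⊥ T P`. -/
noncomputable def KD (N : CompleteNest H) (L : Submodule ℂ (H →L[ℂ] H)) :
    Submodule ℂ (H →L[ℂ] H) :=
  wotSpan {A | ∃ P ∈ N, ∃ T ∈ L, ∃ S ∈ N.nestAlgebra,
    A = P.proj * S * P.coproj * T * P.proj}

/-- The weakly closed span of the operators `P^⊥ T P S P^⊥`. -/
noncomputable def KDelta (N : CompleteNest H) (L : Submodule ℂ (H →L[ℂ] H)) :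
    Submodule ℂ (H →L[ℂ] H) :=
  wotSpan {A | ∃ P ∈ N, ∃ T ∈ L, ∃ S ∈ N.nestAlgebra,
    A = P.coproj * T * P.proj * S * P.coproj}

/-- `K(L) = K_V(L) + K_L(L) + K_D(L) + K_Δ(L)` (the algebraic sum of the four subspaces). -/
noncomputable def K (N : CompleteNest H) (L : Submodule ℂ (H →L[ℂ] H)) :
    Submodule ℂ (H →L[ℂ] H) :=
  N.KV L ⊔ N.KL L ⊔ N.KD L ⊔ N.KDelta L

/-- `φ_M(P) = ⋁ {Q ∈ N : Q B(H) R^⊥ ⊆ M for some R ∈ N with R < P}`. -/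
noncomputable def phi (N : CompleteNest H) (M : Submodule ℂ (H →L[ℂ] H))
    (P : ClosedSubmodule ℂ H) : ClosedSubmodule ℂ H :=
  sSup {Q | Q ∈ N ∧ ∃ R ∈ N, R < P ∧ ∀ B : H →L[ℂ] H, Q.proj * B * R.coproj ∈ M}

/-- `φ` restricts to a left order continuous homomorphism `N → N` (it is order preserving and
commutes with arbitrary suprema) and `M = {T : φ(P)^⊥ T P = 0 for all P ∈ N}`. -/
structure IsAssociated (N : CompleteNest H) (M : Submodule ℂ (H →L[ℂ] H))
    (φ : ClosedSubmodule ℂ H → ClosedSubmodule ℂ H) : Prop where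
  map_mem : ∀ P ∈ N, φ P ∈ N
  mono : ∀ P ∈ N, ∀ Q ∈ N, P ≤ Q → φ P ≤ φ Q
  map_sSup : ∀ X ⊆ N.carrier, φ (sSup X) = sSup (φ '' X)
  mem_iff : ∀ T : H →L[ℂ] H, T ∈ M ↔ ∀ P ∈ N, (φ P).coproj * T * P.proj = 0

/-- The algebra of all `T ∈ D(N)` such that, for every `P ∈ N` with `φ(P) < P_-`, there is a
scalar `λ` with `T (P - φ(P)) = λ (P - φ(P))`. -/
noncomputable def scalarDiagonal (N : CompleteNest H)
    (φ : ClosedSubmodule ℂ H → ClosedSubmodule ℂ H) : Subalgebra ℂ (H →L[ℂ] H) where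
  carrier := {T | T ∈ N.diagonal ∧ ∀ P ∈ N, φ P < N.pred P →
    ∃ c : ℂ, T * (P.proj - (φ P).proj) = c • (P.proj - (φ P).proj)}
  mul_mem' := fun {S T} hS hT => ⟨mul_mem hS.1 hT.1, fun P hP h => by
    obtain ⟨a, ha⟩ := hS.2 P hP h
    obtain ⟨b, hb⟩ := hT.2 P hP h
    exact ⟨b * a, by rw [mul_assoc, hb, mul_smul_comm, ha, smul_smul]⟩⟩
  add_mem' := fun {S T} hS hT => ⟨add_mem hS.1 hT.1, fun P hP h => by
    obtain ⟨a, ha⟩ := hS.2 P hP h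
    obtain ⟨b, hb⟩ := hT.2 P hP h
    exact ⟨a + b, by rw [add_mul, ha, hb, add_smul]⟩⟩
  algebraMap_mem' := fun c => ⟨algebraMap_mem _ c, fun P _ _ =>
    ⟨c, by rw [Algebra.algebraMap_eq_smul_one, smul_mul_assoc, one_mul]⟩⟩

/-- The algebra `D_M` of a bimodule `M`, formed with the map `φ_M`. -/
noncomputable def DK (N : CompleteNest H) (M : Submodule ℂ (H →L[ℂ] H)) :
    Subalgebra ℂ (H →L[ℂ] H) :=
  N.scalarDiagonal (N.phi M)

end CompleteNest

/-! It suffices to write each `T ∈ L` as `A + D` with `A ∈ K(L)` and `D ∈ L` diagonal. Such a `D` is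
automatically scalar on the required intervals: its commutators with `Q B(H) Q^⊥` have corners in
`K_V`, and `K_V` maps `P` into `φ(P)` (`mem_scalarDiagonal`).

Along a finite chain in the nest, `D` is the block diagonal of `T`, and the remaining blocks must be
distributed over `K_V`, `K_D` and `K_L` with norm bounds independent of the chain. Splitting into
upper and lower triangles has no such bounds, as triangular truncation is unbounded. The remedy is a
staircase. If `L` maps `p j` outside `p (b j)` with `j < b j`, then `K_D` contains every operator `p
(b j) B E_j`, where `E_j = p (j + 1) - p j` (`mul_mul_sub_mem_KD`), so that column can be put in
`K_D` down to row `b j`. Below the staircase the nonzero blocks can be grouped with one block per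
column and orthogonal row ranges, and such sums have norm at most `‖T‖` (`norm_sum_mul_mul_le`).

Weak limits along an ultrafilter of finite subsets of the nest then exist, stay in the weakly closed
pieces, and make `D` commute with the whole nest. -/

open Filter Topology InnerProductSpace

/-! ### Weakly closed subspaces and weak limits -/

section WeakOperatorTopology

variable {H : Type*} [NormedAddCommGroup H] [InnerProductSpace ℂ H]

theorem IsWeaklyClosed.comap_mul {M : Submodule ℂ (H →L[ℂ] H)} (hM : IsWeaklyClosed M)
    (S R : H →L[ℂ] H) : IsWeaklyClosed (M.comap (LinearMap.mulLeftRight ℂ (S, R))) := by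
  have h : Continuous fun A : H →WOT[ℂ] H =>
      ((ContinuousLinearMapWOT.ofCLM S).comp A).comp (ContinuousLinearMapWOT.ofCLM R) :=
    (ContinuousLinearMapWOT.continuous_precomp _).comp
      (ContinuousLinearMapWOT.continuous_postcomp _)
  exact hM.preimage h

theorem isWeaklyClosed_wotSpan (X : Set (H →L[ℂ] H)) : IsWeaklyClosed (wotSpan X) :=
  Submodule.isClosed_topologicalClosure _

theorem subset_wotSpan (X : Set (H →L[ℂ] H)) : X ⊆ wotSpan X := fun _ hA =>
  Submodule.le_topologicalClosure _ (Submodule.subset_span hA)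

theorem wotSpan_le {X : Set (H →L[ℂ] H)} {M : Submodule ℂ (H →L[ℂ] H)}
    (hM : IsWeaklyClosed M) (h : X ⊆ M) : wotSpan X ≤ M := by
  intro A hA
  have h1 := Submodule.topologicalClosure_minimal _
    (Submodule.comap_mono (f := (ContinuousLinearMapWOT.linearEquiv (σ := RingHom.id ℂ) (E := H)
      (F := H) ℂ).toLinearMap) (Submodule.span_le.2 h)) hM
  exact h1 hA

theorem wotSpan_le_comap_mul {X : Set (H →L[ℂ] H)} {M : Submodule ℂ (H →L[ℂ] H)}
    (hM : IsWeaklyClosed M) (S R : H →L[ℂ] H) (h : ∀ A ∈ X, S * A * R ∈ M) {A : H →L[ℂ] H}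
    (hA : A ∈ wotSpan X) : S * A * R ∈ M :=
  wotSpan_le (hM.comap_mul S R) (fun A hA => h A hA) hA

variable [CompleteSpace H]

theorem IsWeaklyClosed.mem_of_tendsto {M : Submodule ℂ (H →L[ℂ] H)} (hM : IsWeaklyClosed M)
    {ι : Type*} {l : Filter ι} [l.NeBot] {A : ι → H →L[ℂ] H} {B : H →L[ℂ] H}
    (hA : ∀ x y, Tendsto (fun i => ⟪y, A i x⟫_ℂ) l (𝓝 ⟪y, B x⟫_ℂ)) (h : ∀ᶠ i in l, A i ∈ M) :
    B ∈ M := by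
  have h1 : Tendsto (fun i => ContinuousLinearMapWOT.ofCLM (A i)) l
      (𝓝 (ContinuousLinearMapWOT.ofCLM B)) :=
    ContinuousLinearMapWOT.tendsto_iff_forall_inner_apply_tendsto.2 hA
  exact IsClosed.mem_of_tendsto (s := {A : H →WOT[ℂ] H | A.toCLM ∈ M}) hM h1 h

/-- Bounded families of operators converge weakly along every ultrafilter. -/
theorem exists_weak_limit {ι : Type*} (l : Ultrafilter ι) (A : ι → H →L[ℂ] H) (C : ℝ)
    (hC : ∀ᶠ i in l, ‖A i‖ ≤ C) :
    ∃ B : H →L[ℂ] H, ∀ x y, Tendsto (fun i => ⟪y, A i x⟫_ℂ) l (𝓝 ⟪y, B x⟫_ℂ) := by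
  have hbound : ∀ x y, ∀ᶠ i in l, ‖⟪y, A i x⟫_ℂ‖ ≤ C * ‖y‖ * ‖x‖ := fun x y => by
    filter_upwards [hC] with i hi
    calc ‖⟪y, A i x⟫_ℂ‖ ≤ ‖y‖ * ‖A i x‖ := norm_inner_le_norm _ _
      _ ≤ ‖y‖ * (C * ‖x‖) := by gcongr; exact (A i).le_of_opNorm_le hi x
      _ = _ := by ring
  have hlim : ∀ x y, ∃ z, Tendsto (fun i => ⟪y, A i x⟫_ℂ) l (𝓝 z) := fun x y => by
    have hc := isCompact_closedBall (0 : ℂ) (C * ‖y‖ * ‖x‖)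
    obtain ⟨z, -, hz⟩ := hc.ultrafilter_le_nhds (l.map fun i => ⟪y, A i x⟫_ℂ) (by
      rw [le_principal_iff]
      exact (hbound x y).mono fun i hi => by simpa using hi)
    exact ⟨z, hz⟩
  choose f hf using hlim
  let g : H →L⋆[ℂ] H →L[ℂ] ℂ := LinearMap.mkContinuous₂
    (LinearMap.mk₂'ₛₗ (starRingEnd ℂ) (RingHom.id ℂ) (fun y x => f x y)
      (fun y y' x => tendsto_nhds_unique (hf x (y + y')) (by
        simpa [inner_add_left] using (hf x y).add (hf x y')))
      (fun c y x => tendsto_nhds_unique (hf x (c • y)) (by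
        simpa [inner_smul_left, mul_comm] using (hf x y).const_mul (starRingEnd ℂ c)))
      (fun y x x' => tendsto_nhds_unique (hf (x + x') y) (by
        simpa [inner_add_right] using (hf x y).add (hf x' y)))
      (fun c y x => tendsto_nhds_unique (hf (c • x) y) (by
        simpa [inner_smul_right] using (hf x y).const_mul c))) C
    (fun y x => le_of_tendsto (hf x y).norm (hbound x y))
  -- The operator representing `g` acts in the left slot of the inner product; the adjoint moves it
  -- to the right one.
  refine ⟨star (continuousLinearMapOfBilin g), fun x y => ?_⟩
  have : ⟪y, star (continuousLinearMapOfBilin g) x⟫_ℂ = f x y := by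
    rw [ContinuousLinearMap.star_eq_adjoint, ContinuousLinearMap.adjoint_inner_right,
      continuousLinearMapOfBilin_apply]
    rfl
  rw [this]
  exact hf x y

/-- A weakly closed subspace that contains the rank one operators with range in `P` and
initial vector in `F` contains all operators `P B F`. -/
theorem IsWeaklyClosed.mul_mul_mem {M : Submodule ℂ (H →L[ℂ] H)} (hM : IsWeaklyClosed M)
    {P F : H →L[ℂ] H} (h : ∀ u v, rankOne ℂ (P u) (star F v) ∈ M) (B : H →L[ℂ] H) :
    P * B * F ∈ M := by
  classical
  -- Finite rank cut-offs: `A s x` equals `P B F x` as soon as `F x ∈ s`, so the net is eventually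
  -- constant at each vector.
  let A : Finset H → H →L[ℂ] H := fun s =>
    P * B * (Submodule.span ℂ (s : Set H)).starProjection * F
  refine hM.mem_of_tendsto (l := atTop) (A := A) (fun x y => ?_) (Eventually.of_forall fun s => ?_)
  · refine tendsto_const_nhds.congr' ?_
    filter_upwards [eventually_ge_atTop {F x}] with s hs
    have : (Submodule.span ℂ (s : Set H)).starProjection (F x) = F x :=
      Submodule.starProjection_eq_self_iff.2 (Submodule.subset_span (hs (by simp)))
    simp [A, this]
  · let b := stdOrthonormalBasis ℂ (Submodule.span ℂ (s : Set H))
    have : A s = ∑ i, rankOne ℂ (P (B (b i))) (star F (b i)) := by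
      simp only [A, b.starProjection_eq_sum_rankOne, Finset.mul_sum, Finset.sum_mul]
      refine Finset.sum_congr rfl fun i _ => ?_
      ext x
      simp [ContinuousLinearMap.star_eq_adjoint, ContinuousLinearMap.adjoint_inner_left]
    rw [this]
    exact sum_mem fun i _ => h _ _

end WeakOperatorTopology

/-! ### Algebra of the projections -/

namespace ClosedSubmodule

variable {H : Type*} [NormedAddCommGroup H] [InnerProductSpace ℂ H] [CompleteSpace H]
variable {P Q : ClosedSubmodule ℂ H}

theorem proj_apply_mem (P : ClosedSubmodule ℂ H) (x : H) : P.proj x ∈ P :=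
  P.toSubmodule.starProjection_apply_mem x

theorem proj_apply_eq_self_iff {x : H} : P.proj x = x ↔ x ∈ P :=
  Submodule.starProjection_eq_self_iff

theorem coproj_apply (P : ClosedSubmodule ℂ H) (x : H) : P.coproj x = x - P.proj x := rfl

theorem coproj_apply_eq_zero_iff {x : H} : P.coproj x = 0 ↔ x ∈ P := by
  rw [coproj_apply, sub_eq_zero, eq_comm, proj_apply_eq_self_iff]

theorem inner_proj_left (P : ClosedSubmodule ℂ H) (x y : H) :
    ⟪P.proj x, y⟫_ℂ = ⟪x, P.proj y⟫_ℂ :=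
  Submodule.inner_starProjection_left_eq_right _ x y

theorem inner_coproj_left (P : ClosedSubmodule ℂ H) (x y : H) :
    ⟪P.coproj x, y⟫_ℂ = ⟪x, P.coproj y⟫_ℂ := by
  simp only [coproj_apply, inner_sub_left, inner_sub_right, inner_proj_left]

@[simp]
theorem star_proj (P : ClosedSubmodule ℂ H) : star P.proj = P.proj :=
  isSelfAdjoint_starProjection _

@[simp]
theorem star_coproj (P : ClosedSubmodule ℂ H) : star P.coproj = P.coproj := by
  simp [coproj]

theorem mul_proj_of_le (h : P ≤ Q) : Q.proj * P.proj = P.proj := by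
  ext x
  exact proj_apply_eq_self_iff.2 (h (P.proj_apply_mem x))

theorem proj_mul_of_le (h : P ≤ Q) : P.proj * Q.proj = P.proj := by
  simpa using congrArg star (mul_proj_of_le h)

@[simp]
theorem proj_mul_self (P : ClosedSubmodule ℂ H) : P.proj * P.proj = P.proj :=
  proj_mul_of_le le_rfl

@[simp]
theorem coproj_mul_proj (P : ClosedSubmodule ℂ H) : P.coproj * P.proj = 0 := by
  simp [coproj, sub_mul]

@[simp]
theorem proj_mul_coproj (P : ClosedSubmodule ℂ H) : P.proj * P.coproj = 0 := by
  simp [coproj, mul_sub]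

@[simp]
theorem coproj_mul_self (P : ClosedSubmodule ℂ H) : P.coproj * P.coproj = P.coproj := by
  simp [coproj, mul_sub, sub_mul]

theorem mul_coproj_of_le (h : P ≤ Q) : Q.coproj * P.coproj = Q.coproj := by
  simp [coproj, mul_sub, sub_mul, mul_proj_of_le h]

@[simp]
theorem proj_bot : (⊥ : ClosedSubmodule ℂ H).proj = 0 := by
  simp [proj]

@[simp]
theorem proj_top : (⊤ : ClosedSubmodule ℂ H).proj = 1 :=
  Submodule.starProjection_top'

end ClosedSubmodule

open ClosedSubmodule

/-! ### Nests and their invariant subspaces -/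

namespace CompleteNest

variable {H : Type*} [NormedAddCommGroup H] [InnerProductSpace ℂ H]
variable {N : CompleteNest H} {L : Submodule ℂ (H →L[ℂ] H)}
variable {P Q R : ClosedSubmodule ℂ H} {A B S T : H →L[ℂ] H}

theorem pred_mem (N : CompleteNest H) (P : ClosedSubmodule ℂ H) : N.pred P ∈ N :=
  N.sSup_mem _ fun _ h => h.1

theorem le_pred (hQ : Q ∈ N) (h : Q < P) : Q ≤ N.pred P :=
  le_sSup ⟨hQ, h⟩

theorem pred_le (N : CompleteNest H) (P : ClosedSubmodule ℂ H) : N.pred P ≤ P :=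
  sSup_le fun _ h => h.2.le

theorem lt_or_le (hP : P ∈ N) (hQ : Q ∈ N) : P < Q ∨ Q ≤ P := by
  rcases N.total P hP Q hQ with h | h
  · rcases h.lt_or_eq with h | h
    · exact Or.inl h
    · exact Or.inr h.ge
  · exact Or.inr h

theorem exists_between_of_lt_pred (hQ : Q ∈ N) (h : Q < N.pred P) : ∃ R ∈ N, Q < R ∧ R < P := by
  by_contra! hR
  exact h.not_ge (sSup_le fun R hRm => (lt_or_le hQ hRm.1).resolve_left fun hlt =>
    hR R hRm.1 hlt hRm.2)

/-- Every finite subset of the nest is contained in a finite chain from `0` to `I`. -/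
theorem exists_chain (N : CompleteNest H) (s : Finset (ClosedSubmodule ℂ H))
    (hs : ∀ P ∈ s, P ∈ N) : ∃ p : ℕ → ClosedSubmodule ℂ H, Monotone p ∧ (∀ i, p i ∈ N) ∧
      p 0 = ⊥ ∧ (∃ n, p n = ⊤) ∧ ∀ P ∈ s, ∃ i, p i = P := by
  classical
  let t := insert ⊤ s
  have ht : ∀ P ∈ t, P ∈ N := fun P hP => by
    rcases Finset.mem_insert.1 hP with rfl | h
    exacts [N.top_mem, hs P h]
  -- The rank of `P` in `t`. The chain is shifted by one, `p (r P + 1) = P`, so that `p 0` is the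
  -- empty supremum `⊥`.
  let r : ClosedSubmodule ℂ H → ℕ := fun P => (t.filter (· < P)).card
  have hr : ∀ P ∈ t, ∀ Q ∈ t, r Q ≤ r P → Q ≤ P := fun P hP Q hQ h => by
    refine (lt_or_le (ht P hP) (ht Q hQ)).resolve_left fun hlt => h.not_gt ?_
    refine Finset.card_lt_card (Finset.ssubset_iff_of_subset (fun R hR => ?_) |>.2
      ⟨P, Finset.mem_filter.2 ⟨hP, hlt⟩, by simp⟩)
    rw [Finset.mem_filter] at hR ⊢
    exact ⟨hR.1, hR.2.trans hlt⟩
  have hpt : ∀ P ∈ t, sSup {Q | Q ∈ t ∧ r Q < r P + 1} = P := fun P hP =>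
    le_antisymm (sSup_le fun Q hQ => hr P hP Q hQ.1 (Nat.lt_succ_iff.1 hQ.2))
      (le_sSup ⟨hP, Nat.lt_succ_self _⟩)
  refine ⟨fun i => sSup {Q | Q ∈ t ∧ r Q < i}, fun i j hij => sSup_le_sSup fun Q hQ =>
    ⟨hQ.1, hQ.2.trans_le hij⟩, fun i => N.sSup_mem _ fun Q hQ => ht Q hQ.1, by simp,
    ⟨_, hpt ⊤ (Finset.mem_insert_self _ _)⟩, fun P hP => ⟨_, hpt P (Finset.mem_insert_of_mem hP)⟩⟩

theorem rankOne_mem_nestAlgebra (hP : P ∈ N) {u v : H} (hu : u ∈ P)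
    (hv : ∀ x ∈ N.pred P, ⟪v, x⟫_ℂ = 0) : rankOne ℂ u v ∈ N.nestAlgebra := by
  intro Q hQ x hx
  rcases lt_or_le hQ hP with h | h
  · simp [hv x (le_pred hQ h hx), zero_mem]
  · exact Q.toSubmodule.smul_mem _ (h hu)

variable [CompleteSpace H]

theorem mul_proj_of_mem_nestAlgebra (hS : S ∈ N.nestAlgebra) (hP : P ∈ N) :
    P.proj * S * P.proj = S * P.proj := by
  ext x
  exact proj_apply_eq_self_iff.2 (hS P hP _ (P.proj_apply_mem x))

theorem coproj_mul_of_mem_nestAlgebra (hS : S ∈ N.nestAlgebra) (hP : P ∈ N) :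
    P.coproj * S * P.coproj = P.coproj * S := by
  have h := mul_proj_of_mem_nestAlgebra hS hP
  simp only [coproj, mul_sub, sub_mul, one_mul, mul_one, h]
  abel

theorem proj_mem_nestAlgebra (hP : P ∈ N) : P.proj ∈ N.nestAlgebra := by
  intro Q hQ x hx
  rcases N.total P hP Q hQ with h | h
  · exact h (P.proj_apply_mem x)
  · rwa [proj_apply_eq_self_iff.2 (h hx)]

theorem coproj_mem_nestAlgebra (hP : P ∈ N) : P.coproj ∈ N.nestAlgebra :=
  sub_mem (one_mem _) (proj_mem_nestAlgebra hP)

theorem proj_mul_mul_coproj_mem_nestAlgebra (hP : P ∈ N) (B : H →L[ℂ] H) :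
    P.proj * B * P.coproj ∈ N.nestAlgebra := by
  intro Q hQ x hx
  rcases N.total P hP Q hQ with h | h
  · exact h (P.proj_apply_mem _)
  · simp [coproj_apply_eq_zero_iff.2 (h hx), zero_mem]

/-- A closed subspace that is invariant under the nest algebra belongs to the nest. -/
theorem mem_of_invariant {M : ClosedSubmodule ℂ H}
    (hM : ∀ S ∈ N.nestAlgebra, ∀ x ∈ M, S x ∈ M) : M ∈ N := by
  obtain ⟨Q, hQ, hMQ, hmin⟩ : ∃ Q ∈ N, M ≤ Q ∧ ∀ R ∈ N, M ≤ R → Q ≤ R :=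
    ⟨sInf {Q | Q ∈ N ∧ M ≤ Q}, N.sInf_mem _ fun _ h => h.1, le_sInf fun _ h => h.2,
      fun R hR h => sInf_le ⟨hR, h⟩⟩
  suffices Q ≤ M from le_antisymm this hMQ ▸ hQ
  intro u hu
  -- With `Q` the least nest element above `M`, rank one operators of the nest algebra move some `x
  -- ∈ M` onto any prescribed vector. If `M ≤ Q_-`, then `Q = Q_-` and this is done inside each `R <
  -- Q`; otherwise `x ∈ M` can be taken outside `Q_-`.
  by_cases h : M ≤ N.pred Q
  · have hle : Q ≤ N.pred Q := hmin _ (N.pred_mem Q) h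
    refine (sSup_le (a := M) ?_ : N.pred Q ≤ M) (hle hu)
    rintro R ⟨hR, hRQ⟩ w hw
    have : ¬ M ≤ R := fun h => (hmin R hR h).not_gt hRQ
    obtain ⟨x, hx, hxR⟩ := Set.not_subset.1 this
    have hne : R.coproj x ≠ 0 := fun h => hxR (coproj_apply_eq_zero_iff.1 h)
    have := hM _ (proj_mul_mul_coproj_mem_nestAlgebra hR (rankOne ℂ w (R.coproj x))) x hx
    simp only [mul_apply_eq_comp, rankOne_apply, map_smul,
      proj_apply_eq_self_iff.2 hw] at this
    exact (M.toSubmodule.smul_mem_iff (inner_self_ne_zero.2 hne)).1 this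
  · obtain ⟨x, hx, hxR⟩ := Set.not_subset.1 h
    have hne : (N.pred Q).coproj x ≠ 0 := fun h => hxR (coproj_apply_eq_zero_iff.1 h)
    have := hM _ (rankOne_mem_nestAlgebra hQ hu (v := (N.pred Q).coproj x) fun y hy => by
      rw [inner_coproj_left, coproj_apply_eq_zero_iff.2 hy, inner_zero_right]) x hx
    have hcc : (N.pred Q).coproj ((N.pred Q).coproj x) = (N.pred Q).coproj x :=
      DFunLike.congr_fun (coproj_mul_self _) x
    rw [rankOne_apply, ← hcc, inner_coproj_left] at this
    exact (M.toSubmodule.smul_mem_iff (inner_self_ne_zero.2 hne)).1 this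

/-! ### Corners of a Lie module -/

theorem IsLieModule.upper_mem_and_lower_mem (hLie : N.IsLieModule L) (hP : P ∈ N) (hT : T ∈ L) :
    P.proj * T * P.coproj ∈ L ∧ P.coproj * T * P.proj ∈ L := by
  have h1 := hLie T hT _ (proj_mem_nestAlgebra hP)
  have h2 := hLie _ h1 _ (proj_mem_nestAlgebra hP)
  have hPP := P.proj_mul_self
  -- One commutator with `P` gives `P^⊥ T P - P T P^⊥`, the second gives `P^⊥ T P + P T P^⊥`; half
  -- the sum and half the difference isolate the corners.
  have e1 : P.proj * T * P.coproj =
      (2⁻¹ : ℂ) • (((T * P.proj - P.proj * T) * P.proj - P.proj * (T * P.proj - P.proj * T))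
        - (T * P.proj - P.proj * T)) := by
    rw [eq_inv_smul_iff₀ two_ne_zero, two_smul]
    simp only [coproj, mul_sub, sub_mul, mul_one, mul_assoc, hPP]
    simp only [← mul_assoc, hPP]
    abel
  have e2 : P.coproj * T * P.proj =
      (2⁻¹ : ℂ) • (((T * P.proj - P.proj * T) * P.proj - P.proj * (T * P.proj - P.proj * T))
        + (T * P.proj - P.proj * T)) := by
    rw [eq_inv_smul_iff₀ two_ne_zero, two_smul]
    simp only [coproj, mul_sub, sub_mul, one_mul, mul_assoc, hPP]
    simp only [← mul_assoc, hPP]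
    abel
  rw [e1, e2]
  exact ⟨L.smul_mem _ (sub_mem h2 h1), L.smul_mem _ (add_mem h2 h1)⟩

theorem IsLieModule.upper_mem_KV (hLie : N.IsLieModule L) (hP : P ∈ N) (hQ : Q ∈ N) (hPQ : P ≤ Q)
    (hT : T ∈ L) : P.proj * T * Q.coproj ∈ N.KV L := by
  refine subset_wotSpan _ ⟨P, hP, _, (hLie.upper_mem_and_lower_mem hQ hT).1, ?_⟩
  simp only [← mul_assoc, proj_mul_of_le hPQ]
  rw [mul_assoc _ Q.coproj, mul_coproj_of_le hPQ]

theorem IsLieModule.lower_mem_KL (hLie : N.IsLieModule L) (hP : P ∈ N) (hQ : Q ∈ N) (hPQ : Q ≤ P)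
    (hT : T ∈ L) : P.coproj * T * Q.proj ∈ N.KL L := by
  refine subset_wotSpan _ ⟨P, hP, _, (hLie.upper_mem_and_lower_mem hQ hT).2, ?_⟩
  simp only [← mul_assoc, mul_coproj_of_le hPQ]
  rw [mul_assoc _ Q.proj, proj_mul_of_le hPQ]

theorem IsLieModule.KV_le (hLie : N.IsLieModule L) (hL : IsWeaklyClosed L) : N.KV L ≤ L := by
  refine wotSpan_le hL ?_
  rintro _ ⟨P, hP, T, hT, rfl⟩
  exact (hLie.upper_mem_and_lower_mem hP hT).1

theorem IsLieModule.KL_le (hLie : N.IsLieModule L) (hL : IsWeaklyClosed L) : N.KL L ≤ L := by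
  refine wotSpan_le hL ?_
  rintro _ ⟨P, hP, T, hT, rfl⟩
  exact (hLie.upper_mem_and_lower_mem hP hT).2

/-- `K_V` is a left module over the nest algebra. -/
theorem IsLieModule.mul_mem_KV (hLie : N.IsLieModule L) (hS : S ∈ N.nestAlgebra)
    (hA : A ∈ N.KV L) : S * A ∈ N.KV L := by
  suffices S * A * 1 ∈ N.KV L by rwa [mul_one] at this
  refine wotSpan_le_comap_mul (isWeaklyClosed_wotSpan _) S 1 ?_ hA
  rintro _ ⟨P, hP, T, hT, rfl⟩
  -- Since `P^⊥ S P = 0`, the commutator of `P T P^⊥` with `S P` is `-S P T P^⊥`, again a corner of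
  -- an element of `L`.
  have hS' : S * P.proj ∈ N.nestAlgebra := mul_mem hS (proj_mem_nestAlgebra hP)
  have h1 := hLie _ (hLie.upper_mem_and_lower_mem hP hT).1 _ hS'
  refine subset_wotSpan _ ⟨P, hP, _, neg_mem h1, ?_⟩
  have hSP := mul_proj_of_mem_nestAlgebra hS hP
  have e : P.proj * T * P.coproj * (S * P.proj) = 0 := by
    rw [← hSP]
    simp only [← mul_assoc]
    rw [mul_assoc _ P.coproj, coproj_mul_proj]
    simp
  rw [e]
  simp only [zero_sub, neg_neg, mul_one, ← mul_assoc, hSP]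
  simp only [mul_assoc, coproj_mul_self]
  rw [← mul_assoc P.proj P.proj, proj_mul_self]

/-- `K_V` is a right module over the nest algebra. -/
theorem IsLieModule.mem_KV_mul (hLie : N.IsLieModule L) (hS : S ∈ N.nestAlgebra)
    (hA : A ∈ N.KV L) : A * S ∈ N.KV L := by
  suffices 1 * A * S ∈ N.KV L by rwa [one_mul] at this
  refine wotSpan_le_comap_mul (isWeaklyClosed_wotSpan _) 1 S ?_ hA
  rintro _ ⟨P, hP, T, hT, rfl⟩
  have hS' : P.coproj * S ∈ N.nestAlgebra := mul_mem (coproj_mem_nestAlgebra hP) hS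
  have h1 := hLie _ (hLie.upper_mem_and_lower_mem hP hT).1 _ hS'
  refine subset_wotSpan _ ⟨P, hP, _, h1, ?_⟩
  have hSP := coproj_mul_of_mem_nestAlgebra hS hP
  have e : P.coproj * S * (P.proj * T * P.coproj) = 0 := by
    rw [← hSP]
    simp only [← mul_assoc]
    rw [mul_assoc _ P.coproj P.proj, coproj_mul_proj]
    simp
  rw [e, sub_zero, one_mul]
  simp only [← mul_assoc, proj_mul_self]
  simp only [mul_assoc]
  simp only [← mul_assoc P.coproj, coproj_mul_self, hSP]

/-- If some `T ∈ L` does not map `Q` into `P`, where `Q ≤ P`, then `K_D` contains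
`P B(H) (P - Q)`. -/
theorem IsLieModule.mul_mul_sub_mem_KD (hLie : N.IsLieModule L) (hP : P ∈ N) (hQ : Q ∈ N)
    (hQP : Q ≤ P) (h : ∃ T ∈ L, P.coproj * T * Q.proj ≠ 0) (B : H →L[ℂ] H) :
    P.proj * B * (P.proj - Q.proj) ∈ N.KD L := by
  have hcl : IsWeaklyClosed (N.KD L) := isWeaklyClosed_wotSpan _
  refine hcl.mul_mul_mem (fun u v => ?_) B
  set w := star (P.proj - Q.proj) v with hw
  have hu := P.proj_apply_mem u
  set u' := P.proj u
  -- the vectors `w` for which `rankOne u' w` lies in `K_D` form a closed subspace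
  have hclosed : IsClosed {w | rankOne ℂ u' w ∈ N.KD L} := by
    refine hcl.preimage (f := fun w => ContinuousLinearMapWOT.ofCLM (rankOne ℂ u' w)) ?_
    refine ContinuousLinearMapWOT.continuous_iff.2 fun x y => ?_
    simp only [ContinuousLinearMapWOT.ofCLM_apply, rankOne_apply]
    fun_prop
  let W : Submodule ℂ H :=
    { carrier := {w | rankOne ℂ u' w ∈ N.KD L}
      add_mem' := fun {a b} ha hb => by
        simp only [Set.mem_ofPred_eq, map_add] at *
        exact add_mem ha hb
      zero_mem' := by simp
      smul_mem' := fun c a ha => by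
        simp only [Set.mem_ofPred_eq, map_smulₛₗ] at *
        exact (N.KD L).smul_mem _ ha }
  -- With `S = P (u' ⊗ y) P^⊥`, the generator `P S P^⊥ T P` of `K_D` is the rank one operator `u' ⊗
  -- P T* P^⊥ y`.
  have hmem : ∀ T ∈ L, ∀ y, P.proj (star T (P.coproj y)) ∈ W := fun T hT y => by
    refine subset_wotSpan _ ⟨P, hP, T, hT, _,
      proj_mul_mul_coproj_mem_nestAlgebra hP (rankOne ℂ u' y), ?_⟩
    ext x
    have hu2 : P.proj u' = u' := proj_apply_eq_self_iff.2 hu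
    have e1 : P.coproj (P.coproj (T (P.proj x))) = P.coproj (T (P.proj x)) :=
      DFunLike.congr_fun P.coproj_mul_self _
    simp [hu2, inner_proj_left, inner_coproj_left, ContinuousLinearMap.star_eq_adjoint,
      ContinuousLinearMap.adjoint_inner_left, e1]
  suffices w ∈ W from this
  have hW : W.topologicalClosure = W := IsClosed.submodule_topologicalClosure_eq hclosed
  rw [← hW, ← Submodule.orthogonal_orthogonal_eq_closure, Submodule.mem_orthogonal]
  intro x hx
  -- the common kernel of the operators `P^⊥ T P`
  have hker : ∀ T ∈ L, P.coproj (T (P.proj x)) = 0 := fun T hT => by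
    refine ext_inner_left ℂ fun y => ?_
    have := (Submodule.mem_orthogonal _ _).1 hx _ (hmem T hT y)
    rwa [inner_proj_left, ContinuousLinearMap.star_eq_adjoint,
      ContinuousLinearMap.adjoint_inner_left, inner_coproj_left, ← inner_zero_right y] at this
  -- Otherwise some `S ∈ Q B(H) Q^⊥` sends `P x` to a nonzero multiple of `Q z`. As `S` has range in
  -- `P`, applying `P^⊥ [T, S]` to `P x` leaves a multiple of `P^⊥ T Q z`, which therefore vanishes
  -- for every `z`.
  have hxQ : P.proj x ∈ Q := by
    by_contra hxQ
    obtain ⟨T, hT, hne⟩ := h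
    have hne' : Q.coproj (P.proj x) ≠ 0 := fun h => hxQ (coproj_apply_eq_zero_iff.1 h)
    refine hne (ContinuousLinearMap.ext fun z => ?_)
    have hS := proj_mul_mul_coproj_mem_nestAlgebra hQ
      (rankOne ℂ (Q.proj z) (Q.coproj (P.proj x)))
    have h1 := hker _ (hLie T hT _ hS)
    have hSx : (Q.proj * rankOne ℂ (Q.proj z) (Q.coproj (P.proj x)) * Q.coproj) (P.proj x) =
        ⟪Q.coproj (P.proj x), Q.coproj (P.proj x)⟫_ℂ • Q.proj z := by
      simp [proj_apply_eq_self_iff.2 (Q.proj_apply_mem z)]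
    rw [sub_apply, mul_apply_eq_comp,
      mul_apply_eq_comp _ T, hSx, map_sub,
      coproj_apply_eq_zero_iff.2 (hQP (by
        rw [mul_assoc]; exact Q.proj_apply_mem _) :
        (Q.proj * rankOne ℂ (Q.proj z) (Q.coproj (P.proj x)) * Q.coproj) (T (P.proj x)) ∈ P),
      sub_zero, map_smul, map_smul] at h1
    exact (smul_eq_zero.1 h1).resolve_left (inner_self_ne_zero.2 hne')
  have e : (P.proj - Q.proj) x = 0 := by
    have h1 : Q.proj (P.proj x) = P.proj x := proj_apply_eq_self_iff.2 hxQ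
    have h2 : Q.proj (P.proj x) = Q.proj x := DFunLike.congr_fun (proj_mul_of_le hQP) x
    rw [sub_apply, ← h2, h1, sub_self]
  rw [hw, ContinuousLinearMap.star_eq_adjoint, ContinuousLinearMap.adjoint_inner_right, e,
    inner_zero_left]

end CompleteNest

/-! ### The map `φ` and diagonal elements of a Lie module -/

namespace CompleteNest

variable {H : Type*} [NormedAddCommGroup H] [InnerProductSpace ℂ H] [CompleteSpace H]
variable {N : CompleteNest H} {L M : Submodule ℂ (H →L[ℂ] H)}
variable {P Q R : ClosedSubmodule ℂ H} {A B D S T : H →L[ℂ] H}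

theorem phi_mem (N : CompleteNest H) (M : Submodule ℂ (H →L[ℂ] H)) (P : ClosedSubmodule ℂ H) :
    N.phi M P ∈ N :=
  N.sSup_mem _ fun _ h => h.1

theorem KV_le_K (N : CompleteNest H) (L : Submodule ℂ (H →L[ℂ] H)) : N.KV L ≤ N.K L :=
  le_sup_of_le_left (le_sup_of_le_left le_sup_left)

theorem KL_le_K (N : CompleteNest H) (L : Submodule ℂ (H →L[ℂ] H)) : N.KL L ≤ N.K L :=
  le_sup_of_le_left (le_sup_of_le_left le_sup_right)

theorem KD_le_K (N : CompleteNest H) (L : Submodule ℂ (H →L[ℂ] H)) : N.KD L ≤ N.K L :=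
  le_sup_of_le_left le_sup_right

/-- The vectors `w` with `w ⊗ v ∈ K_V` for all `v ⊥ R_-` form a closed subspace `W`, invariant
because `K_V` is a left module, hence in the nest. Then `W B(H) (R_-)^⊥ ⊆ K_V` and `R_- < P` give `W
≤ φ(P)`, while `A (u ⊗ v) = A u ⊗ v` puts `A u` in `W`. -/
theorem IsLieModule.apply_mem_phi_of_pred_lt (hLie : N.IsLieModule L) (hKV : N.KV L ≤ M)
    (hA : A ∈ N.KV L) (hR : R ∈ N) (hRP : N.pred R < P) {u : H} (hu : u ∈ R) :
    A u ∈ N.phi M P := by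
  have hcl : IsWeaklyClosed (N.KV L) := isWeaklyClosed_wotSpan _
  let W : ClosedSubmodule ℂ H :=
    { carrier := {w | ∀ v, (∀ x ∈ N.pred R, ⟪v, x⟫_ℂ = 0) → rankOne ℂ w v ∈ N.KV L}
      add_mem' := fun {a b} ha hb v hv => by
        rw [map_add, add_apply]
        exact add_mem (ha v hv) (hb v hv)
      zero_mem' := by simp
      smul_mem' := fun c a ha v hv => by
        rw [map_smul, smul_apply]
        exact (N.KV L).smul_mem _ (ha v hv)
      isClosed' := by
        simp only [Set.ofPred_forall]
        refine isClosed_iInter fun v => isClosed_iInter fun hv => ?_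
        refine hcl.preimage (f := fun w => ContinuousLinearMapWOT.ofCLM (rankOne ℂ w v)) ?_
        refine ContinuousLinearMapWOT.continuous_iff.2 fun x y => ?_
        simp only [ContinuousLinearMapWOT.ofCLM_apply, rankOne_apply]
        fun_prop }
  have hWmem : ∀ w, w ∈ W ↔
    ∀ v, (∀ x ∈ N.pred R, ⟪v, x⟫_ℂ = 0) → rankOne ℂ w v ∈ N.KV L := fun _ => Iff.rfl
  have hW : W ∈ N := mem_of_invariant fun S hS w hw v hv => by
    have := hLie.mul_mem_KV hS (hw v hv)
    rwa [ContinuousLinearMap.mul_def, comp_rankOne] at this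
  have hle : W ≤ N.phi M P := by
    refine le_sSup ⟨hW, _, N.pred_mem R, hRP, fun B => hKV (hcl.mul_mul_mem (fun u v => ?_) B)⟩
    refine W.proj_apply_mem u _ fun x hx => ?_
    rw [star_coproj, inner_coproj_left, coproj_apply_eq_zero_iff.2 hx, inner_zero_right]
  refine hle ((hWmem _).2 fun v hv => ?_)
  have := hLie.mem_KV_mul (rankOne_mem_nestAlgebra hR hu hv) hA
  rwa [ContinuousLinearMap.mul_def, comp_rankOne] at this

/-- If `P_- < P`, the previous lemma applies with `R = P`. If `P_- = P`, then `P` is the supremum of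
the `R < P`, each with `R_- < P`, and the preimage of `φ(P)` under `A` is closed. -/
theorem IsLieModule.apply_mem_phi (hLie : N.IsLieModule L) (hKV : N.KV L ≤ M)
    (hA : A ∈ N.KV L) (hP : P ∈ N) {x : H} (hx : x ∈ P) : A x ∈ N.phi M P := by
  rcases (N.pred_le P).lt_or_eq with h | h
  · exact hLie.apply_mem_phi_of_pred_lt hKV hA hP h hx
  · have hle : N.pred P ≤ (N.phi M P).comap A := sSup_le fun R hR u hu =>
      hLie.apply_mem_phi_of_pred_lt hKV hA hR.1 ((N.pred_le R).trans_lt hR.2) hu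
    exact hle (h.symm ▸ hx)

theorem mul_proj_eq_of_mem_diagonal (hD : D ∈ N.diagonal) (hP : P ∈ N) :
    D * P.proj = P.proj * D := by
  have h1 := mul_proj_of_mem_nestAlgebra hD.1 hP
  have h2 := congrArg star (mul_proj_of_mem_nestAlgebra hD.2 hP)
  simp only [star_mul, star_star, star_proj, ← mul_assoc] at h2
  rw [← h1, h2]

theorem mem_diagonal_of_commute (hD : ∀ P ∈ N, D * P.proj = P.proj * D) : D ∈ N.diagonal := by
  refine ⟨fun P hP x hx => ?_, fun P hP x hx => ?_⟩
  · have h : D (P.proj x) = P.proj (D x) := DFunLike.congr_fun (hD P hP) x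
    rw [proj_apply_eq_self_iff.2 hx] at h
    exact h ▸ P.proj_apply_mem _
  · have h : P.proj (star D x) = star D (P.proj x) := by
      simpa using DFunLike.congr_fun (congrArg star (hD P hP)) x
    rw [proj_apply_eq_self_iff.2 hx] at h
    exact h ▸ P.proj_apply_mem _

theorem exists_orthogonal_of_lt (h : P < Q) : ∃ v ∈ Q, v ≠ 0 ∧ P.proj v = 0 := by
  obtain ⟨x, hx, hxP⟩ := Set.not_subset.1 h.not_ge
  refine ⟨P.coproj x, Q.toSubmodule.sub_mem hx (h.le (P.proj_apply_mem x)), fun h0 =>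
    hxP (coproj_apply_eq_zero_iff.1 h0), DFunLike.congr_fun P.proj_mul_coproj x⟩

/-- A diagonal element of `L` is scalar on the intervals `P - φ(P)` with `φ(P) < P_-`. -/
theorem mem_scalarDiagonal {φ : ClosedSubmodule ℂ H → ClosedSubmodule ℂ H}
    (hφ : ∀ P ∈ N, φ P ∈ N)
    (hLie : N.IsLieModule L) (hKV : ∀ A ∈ N.KV L, ∀ P ∈ N, ∀ x ∈ P, A x ∈ φ P)
    (hDL : D ∈ L) (hD : D ∈ N.diagonal) : D ∈ N.scalarDiagonal φ := by
  refine ⟨hD, fun P hP hlt => ?_⟩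
  -- Splitting `P - φ(P)` at `Q` leaves two nonzero pieces; `key` compares `D` on one with `D` on
  -- the other, forcing a common scalar.
  obtain ⟨Q, hQ, hφQ, hQP⟩ := exists_between_of_lt_pred (hφ P hP) hlt
  have hcomm : ∀ R ∈ N, ∀ x, D (R.proj x) = R.proj (D x) := fun R hR x =>
    DFunLike.congr_fun (mul_proj_eq_of_mem_diagonal hD hR) x
  -- the identity `D u ⊗ v = u ⊗ D* v`
  have key : ∀ u v x : H, u ∈ Q → (φ P).proj u = 0 → x ∈ P → Q.proj x = 0 →
      ⟪v, x⟫_ℂ • D u = ⟪v, D x⟫_ℂ • u := by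
    intro u v x hu hu0 hx hx0
    have hS := proj_mul_mul_coproj_mem_nestAlgebra hQ (rankOne ℂ u v)
    have hmem : Q.proj * (D * (Q.proj * rankOne ℂ u v * Q.coproj) -
        (Q.proj * rankOne ℂ u v * Q.coproj) * D) * Q.coproj ∈ N.KV L :=
      hLie.upper_mem_KV hQ hQ le_rfl (hLie D hDL _ hS)
    -- The value of the corner at `x` lies in `φ(P)` and is also orthogonal to it, hence is zero.
    have h := coproj_apply_eq_zero_iff.2 (hKV _ hmem P hP x hx)
    simp only [mul_apply_eq_comp, sub_apply, coproj_apply, hx0, sub_zero, ← hcomm Q hQ, map_sub,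
      rankOne_apply, map_smul, proj_apply_eq_self_iff.2 hu,
      map_zero, ← hcomm _ (hφ P hP), hu0] at h
    exact sub_eq_zero.1 h
  obtain ⟨u₀, hu₀, hu₀ne, hu₀φ⟩ := exists_orthogonal_of_lt hφQ
  obtain ⟨v₀, hv₀, hv₀ne, hv₀Q⟩ := exists_orthogonal_of_lt hQP
  set c : ℂ := (⟪v₀, v₀⟫_ℂ)⁻¹ * ⟪v₀, D v₀⟫_ℂ with hc
  have hlow : ∀ u ∈ Q, (φ P).proj u = 0 → D u = c • u := fun u hu hu0 => by
    rw [hc, mul_smul, ← key u v₀ v₀ hu hu0 hv₀ hv₀Q, inv_smul_smul₀ (inner_self_ne_zero.2 hv₀ne)]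
  have hupp : ∀ x ∈ P, Q.proj x = 0 → D x = c • x := fun x hx hx0 => by
    refine ext_inner_left ℂ fun v => ?_
    have h := key u₀ v x hu₀ hu₀φ hx hx0
    rw [hlow u₀ hu₀ hu₀φ, smul_smul] at h
    rw [inner_smul_right, mul_comm, smul_left_injective ℂ hu₀ne h]
  refine ⟨c, ContinuousLinearMap.ext fun x => ?_⟩
  have h1 := hlow (Q.proj x - (φ P).proj x)
    (Q.toSubmodule.sub_mem (Q.proj_apply_mem x) (hφQ.le ((φ P).proj_apply_mem x))) (by
      rw [map_sub, sub_eq_zero]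
      exact (DFunLike.congr_fun (proj_mul_of_le hφQ.le) x).trans
        (DFunLike.congr_fun (φ P).proj_mul_self x).symm)
  have h2 := hupp (P.proj x - Q.proj x)
    (P.toSubmodule.sub_mem (P.proj_apply_mem x) (hQP.le (Q.proj_apply_mem x))) (by
      rw [map_sub, sub_eq_zero]
      exact (DFunLike.congr_fun (proj_mul_of_le hQP.le) x).trans
        (DFunLike.congr_fun Q.proj_mul_self x).symm)
  have e : (P.proj - (φ P).proj) x = (P.proj x - Q.proj x) + (Q.proj x - (φ P).proj x) := by
    simp
  rw [mul_apply_eq_comp, smul_apply, e, map_add, h1, h2, smul_add]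

end CompleteNest

/-! ### Norms of sums of blocks -/

section BlockSums

variable {H : Type*} [NormedAddCommGroup H] [InnerProductSpace ℂ H]
variable {ι κ : Type*}

theorem norm_sum_sq_of_pairwise_inner_eq_zero {v : ι → H} (s : Finset ι)
    (hv : ∀ i ∈ s, ∀ j ∈ s, i ≠ j → ⟪v i, v j⟫_ℂ = 0) :
    ‖∑ i ∈ s, v i‖ ^ 2 = ∑ i ∈ s, ‖v i‖ ^ 2 := by
  classical
  have h : ⟪∑ i ∈ s, v i, ∑ i ∈ s, v i⟫_ℂ = ∑ i ∈ s, ⟪v i, v i⟫_ℂ := by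
    rw [sum_inner]
    refine Finset.sum_congr rfl fun i hi => ?_
    rw [inner_sum, Finset.sum_eq_single_of_mem i hi fun j hj hji => hv i hi j hj hji.symm]
  simp only [inner_self_eq_norm_sq_to_K] at h
  exact_mod_cast h

variable [CompleteSpace H] {E : ι → H →L[ℂ] H} {F : κ → H →L[ℂ] H}

theorem OrthogonalIdempotents.inner_apply_eq_zero (hE : OrthogonalIdempotents E)
    (hE' : ∀ i, IsSelfAdjoint (E i)) {i j : ι} (hij : i ≠ j) (x y : H) :
    ⟪E i x, E j y⟫_ℂ = 0 := by
  rw [← (hE' i).star_eq, ContinuousLinearMap.star_eq_adjoint,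
    ContinuousLinearMap.adjoint_inner_left, ← mul_apply_eq_comp, hE.ortho hij, zero_apply,
    inner_zero_right]

theorem OrthogonalIdempotents.sum_norm_sq_le (hE : OrthogonalIdempotents E)
    (hE' : ∀ i, IsSelfAdjoint (E i)) (s : Finset ι) (x : H) :
    ∑ i ∈ s, ‖E i x‖ ^ 2 ≤ ‖x‖ ^ 2 := by
  have h1 := norm_sum_sq_of_pairwise_inner_eq_zero (v := fun i => E i x) s
    fun i _ j _ hij => hE.inner_apply_eq_zero hE' hij x x
  have h2 : ⟪x, ∑ i ∈ s, E i x⟫_ℂ = ((∑ i ∈ s, ‖E i x‖ ^ 2 : ℝ) : ℂ) := by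
    rw [inner_sum]
    push_cast
    refine Finset.sum_congr rfl fun i _ => ?_
    have h3 : E i (E i x) = E i x := DFunLike.congr_fun (hE.idem i) x
    rw [← h3, ← (hE' i).star_eq, ContinuousLinearMap.star_eq_adjoint,
      ContinuousLinearMap.adjoint_inner_right, ← ContinuousLinearMap.star_eq_adjoint,
      (hE' i).star_eq, h3, inner_self_eq_norm_sq_to_K]
    rfl
  have h4 : ∑ i ∈ s, ‖E i x‖ ^ 2 ≤ ‖x‖ * ‖∑ i ∈ s, E i x‖ := by
    have := norm_inner_le_norm (𝕜 := ℂ) x (∑ i ∈ s, E i x)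
    rw [h2, Complex.norm_real] at this
    exact (le_abs_self _).trans this
  nlinarith [norm_nonneg x, norm_nonneg (∑ i ∈ s, E i x), sq_nonneg (‖x‖ - ‖∑ i ∈ s, E i x‖)]

/-- A sum of blocks, at most one in each column, has norm at most that of the operator. -/
theorem OrthogonalIdempotents.norm_sum_mul_mul_le (hE : OrthogonalIdempotents E)
    (hE' : ∀ i, IsSelfAdjoint (E i)) (hF : OrthogonalIdempotents F)
    (hF' : ∀ i, IsSelfAdjoint (F i)) (g : ι → κ) (s : Finset ι) (T : H →L[ℂ] H) :
    ‖∑ i ∈ s, F (g i) * T * E i‖ ≤ ‖T‖ := by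
  classical
  refine ContinuousLinearMap.opNorm_le_bound _ (norm_nonneg _) fun x => ?_
  refine le_of_sq_le_sq ?_ (by positivity)
  -- Columns sharing a row `k` are collected, so that Pythagoras applies to the rows and then to
  -- each group of columns.
  have e : (∑ i ∈ s, F (g i) * T * E i) x =
      ∑ k ∈ s.image g, F k (T (∑ i ∈ s with g i = k, E i x)) := by
    simp only [sum_apply, mul_apply_eq_comp, map_sum]
    rw [← Finset.sum_fiberwise_of_maps_to (fun i hi => Finset.mem_image_of_mem g hi)]
    refine Finset.sum_congr rfl fun k _ => Finset.sum_congr rfl fun i hi => ?_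
    rw [(Finset.mem_filter.1 hi).2]
  rw [e, norm_sum_sq_of_pairwise_inner_eq_zero _
    fun i _ j _ hij => hF.inner_apply_eq_zero hF' hij _ _]
  calc ∑ k ∈ s.image g, ‖F k (T (∑ i ∈ s with g i = k, E i x))‖ ^ 2
      ≤ ∑ k ∈ s.image g, ‖T‖ ^ 2 * ∑ i ∈ s with g i = k, ‖E i x‖ ^ 2 := by
        refine Finset.sum_le_sum fun k _ => ?_
        have h1 := hF.sum_norm_sq_le hF' {k} (T (∑ i ∈ s with g i = k, E i x))
        rw [Finset.sum_singleton] at h1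
        refine h1.trans ?_
        rw [← norm_sum_sq_of_pairwise_inner_eq_zero _
          fun i _ j _ hij => hE.inner_apply_eq_zero hE' hij x x, ← mul_pow]
        gcongr
        exact T.le_opNorm _
    _ = ‖T‖ ^ 2 * ∑ i ∈ s, ‖E i x‖ ^ 2 := by
        rw [← Finset.mul_sum,
          Finset.sum_fiberwise_of_maps_to (fun i hi => Finset.mem_image_of_mem g hi)]
    _ ≤ (‖T‖ * ‖x‖) ^ 2 := by
        rw [mul_pow]
        gcongr
        exact hE.sum_norm_sq_le hE' s x

theorem ClosedSubmodule.isSelfAdjoint_proj_sub (P Q : ClosedSubmodule ℂ H) :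
    IsSelfAdjoint (P.proj - Q.proj) := by
  simp [IsSelfAdjoint]

theorem ClosedSubmodule.orthogonalIdempotents_proj_sub {p : ℕ → ClosedSubmodule ℂ H}
    (hp : Monotone p) : OrthogonalIdempotents fun j => (p (j + 1)).proj - (p j).proj := by
  refine ⟨fun j => ?_, ?_⟩
  · have h := hp j.le_succ
    simp [IsIdempotentElem, sub_mul, mul_sub, proj_mul_of_le h, mul_proj_of_le h]
  · have key : ∀ i j, i < j → ((p (i + 1)).proj - (p i).proj) *
        ((p (j + 1)).proj - (p j).proj) = 0 := fun i j h => by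
      have h1 : p (i + 1) ≤ p j := hp h
      have h2 : p i ≤ p j := hp h.le
      have h3 : p j ≤ p (j + 1) := hp j.le_succ
      simp [sub_mul, mul_sub, proj_mul_of_le h1, proj_mul_of_le h2, proj_mul_of_le (h1.trans h3),
        proj_mul_of_le (h2.trans h3)]
    intro i j hij
    rcases hij.lt_or_gt with h | h
    · exact key i j h
    · simpa using congrArg star (key j i h)

end BlockSums

/-! ### Staircase decomposition and passage to the limit -/

namespace CompleteNest

variable {H : Type*} [NormedAddCommGroup H] [InnerProductSpace ℂ H] [CompleteSpace H]
variable {N : CompleteNest H} {L : Submodule ℂ (H →L[ℂ] H)} {T : H →L[ℂ] H}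

/-- The staircase of a subspace `L` along a finite chain: `p (b j + 1)` is the first element of
the chain after `p j` that contains `L (p j)`. -/
theorem exists_staircase (L : Submodule ℂ (H →L[ℂ] H)) {p : ℕ → ClosedSubmodule ℂ H}
    (hp : Monotone p) {n : ℕ} (hn : p n = ⊤) :
    ∃ b : ℕ → ℕ, Monotone b ∧ (∀ j, j ≤ b j) ∧
      (∀ j, ∀ T ∈ L, (p (b j + 1)).coproj * T * (p j).proj = 0) ∧
      ∀ j, j < b j → ∃ T ∈ L, (p (b j)).coproj * T * (p j).proj ≠ 0 := by
  classical
  have hex : ∀ j, ∃ i, j ≤ i ∧ ∀ T ∈ L, (p (i + 1)).coproj * T * (p j).proj = 0 := fun j => by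
    refine ⟨max j n, le_max_left _ _, fun T _ => ?_⟩
    have : p (max j n + 1) = ⊤ :=
      top_le_iff.1 (hn ▸ hp ((le_max_right j n).trans (Nat.le_succ _)))
    simp [this, coproj]
  refine ⟨fun j => Nat.find (hex j), fun j k hjk => ?_, fun j => (Nat.find_spec (hex j)).1,
    fun j => (Nat.find_spec (hex j)).2, fun j hj => ?_⟩
  · obtain ⟨h1, h2⟩ := Nat.find_spec (hex k)
    refine Nat.find_min' _ ⟨hjk.trans h1, fun T hT => ?_⟩
    rw [← mul_proj_of_le (hp hjk), ← mul_assoc, h2 T hT, zero_mul]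
  · beta_reduce at hj ⊢
    obtain ⟨i, hi⟩ : ∃ i, Nat.find (hex j) = i + 1 := Nat.exists_eq_succ_of_ne_zero (by omega)
    have := Nat.find_min (hex j) (m := i) (by omega)
    rw [hi] at hj ⊢
    push Not at this
    exact this (by omega)

/-- The decomposition of an operator of a Lie module along a finite chain in the nest. -/
theorem IsLieModule.exists_decomposition_of_chain (hLie : N.IsLieModule L)
    (hL : IsWeaklyClosed L) {p : ℕ → ClosedSubmodule ℂ H} (hp : Monotone p)
    (hpN : ∀ i, p i ∈ N) (h0 : p 0 = ⊥) {n : ℕ} (hn : p n = ⊤) (hT : T ∈ L) :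
    ∃ D U G Z : H →L[ℂ] H, T = D + U + G + Z ∧ D ∈ L ∧ U ∈ N.KV L ∧ G ∈ N.KD L ∧ Z ∈ N.KL L ∧
      (∀ i, D * (p i).proj = (p i).proj * D) ∧
      ‖D‖ ≤ 7 * ‖T‖ ∧ ‖U‖ ≤ 7 * ‖T‖ ∧ ‖G‖ ≤ 7 * ‖T‖ ∧ ‖Z‖ ≤ 7 * ‖T‖ := by
  classical
  obtain ⟨b, hb, hjb, hzero, hne⟩ := exists_staircase L hp hn
  set E : ℕ → H →L[ℂ] H := fun j => (p (j + 1)).proj - (p j).proj with hEdef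
  have hEo : OrthogonalIdempotents E := orthogonalIdempotents_proj_sub hp
  have hEs : ∀ j, IsSelfAdjoint (E j) := fun j => isSelfAdjoint_proj_sub _ _
  -- `F j` is the band of rows between two consecutive steps of the staircase; monotonicity of `b`
  -- makes the bands orthogonal.
  set F : ℕ → H →L[ℂ] H := fun j => (p (b (j + 1) + 1)).proj - (p (b j + 1)).proj with hFdef
  have hFo : OrthogonalIdempotents F :=
    orthogonalIdempotents_proj_sub (p := fun j => p (b j + 1)) fun i j hij =>
      hp (Nat.add_le_add_right (hb hij) 1)
  have hFs : ∀ j, IsSelfAdjoint (F j) := fun j => isSelfAdjoint_proj_sub _ _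
  have hsumE : ∑ j ∈ Finset.range n, E j = 1 := by
    rw [Finset.sum_range_sub (fun j => (p j).proj), hn, h0]
    simp
  have hsumT : ∑ j ∈ Finset.range n, T * E j = T := by
    rw [← Finset.mul_sum, hsumE, mul_one]
  -- the blocks above and below the diagonal
  have hupper : ∀ j, (p j).proj * T * E j ∈ N.KV L := fun j => by
    have h : (p j).proj * T * E j =
        (p j).proj * T * (p j).coproj - (p j).proj * T * (p (j + 1)).coproj := by
      rw [← mul_sub]; simp [E, coproj]
    rw [h]
    exact sub_mem (hLie.upper_mem_KV (hpN _) (hpN _) le_rfl hT)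
      (hLie.upper_mem_KV (hpN _) (hpN _) (hp j.le_succ) hT)
  have hlower : ∀ c j, j < c → (p c).coproj * T * E j ∈ N.KL L := fun c j hc => by
    rw [hEdef, mul_sub]
    exact sub_mem (hLie.lower_mem_KL (hpN _) (hpN _) (hp hc) hT)
      (hLie.lower_mem_KL (hpN _) (hpN _) (hp hc.le) hT)
  have hlower' : ∀ c d j, j < c → j < d → ((p d).proj - (p c).proj) * T * E j ∈ N.KL L :=
    fun c d j hc hd => by
      have h : ((p d).proj - (p c).proj) * T * E j =
          (p c).coproj * T * E j - (p d).coproj * T * E j := by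
        simp only [coproj, sub_mul]; abel
      rw [h]
      exact sub_mem (hlower c j hc) (hlower d j hd)
  have hbelow : ∀ j, (p (b (j + 1) + 1)).proj * T * E j = T * E j := fun j => by
    have h := hzero (j + 1) T hT
    have hE : (p (j + 1)).proj * E j = E j := by
      simp [E, mul_sub, mul_proj_of_le (hp j.le_succ)]
    have h2 : (p (b (j + 1) + 1)).coproj * T * E j = 0 := by
      rw [← hE, ← mul_assoc, h, zero_mul]
    rw [coproj, sub_mul, sub_mul, one_mul, sub_eq_zero] at h2
    exact h2.symm
  -- In the columns `s` the blocks above the diagonal go to `K_V`. In the columns `t` all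
  -- off-diagonal rows up to `p (b j)` go to `K_D`. The single row `E (b j)` and the bands `F j` are
  -- left for `K_L`.
  let s := {j ∈ Finset.range n | b j = j}
  let t := {j ∈ Finset.range n | ¬ b j = j}
  have hst : ∀ f : ℕ → H →L[ℂ] H, ∑ j ∈ s, f j + ∑ j ∈ t, f j = ∑ j ∈ Finset.range n, f j :=
    fun f => Finset.sum_filter_add_sum_filter_not _ _ _
  let D := ∑ j ∈ Finset.range n, E j * T * E j
  let U := ∑ j ∈ s, (p j).proj * T * E j
  let G := ∑ j ∈ t, ((p (b j)).proj - E j) * T * E j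
  let Z₁ := ∑ j ∈ t, E (b j) * T * E j
  let Z₂ := ∑ j ∈ Finset.range n, F j * T * E j
  have hs : ∀ j ∈ s, E j * T * E j + (p j).proj * T * E j + F j * T * E j = T * E j :=
    fun j hj => by
      have hj : b j = j := (Finset.mem_filter.1 hj).2
      rw [← add_mul, ← add_mul, ← add_mul, ← add_mul, ← hbelow j]
      simp only [E, F, hj]
      congr 2
      abel
  have ht : ∀ j ∈ t, E j * T * E j + ((p (b j)).proj - E j) * T * E j + E (b j) * T * E j
      + F j * T * E j = T * E j := fun j _ => by
    rw [← add_mul, ← add_mul, ← add_mul, ← add_mul, ← add_mul, ← add_mul, ← hbelow j]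
    simp only [E, F]
    congr 2
    abel
  have hsum : T = D + U + G + (Z₁ + Z₂) := by
    have h1 := Finset.sum_congr rfl hs
    have h2 := Finset.sum_congr rfl ht
    simp only [Finset.sum_add_distrib] at h1 h2
    have hD := hst fun j => E j * T * E j
    have hZ := hst fun j => F j * T * E j
    rw [← hsumT, ← hst, ← h1, ← h2]
    simp only [D, U, G, Z₁, Z₂, ← hD, ← hZ]
    abel
  have hnD : ‖D‖ ≤ ‖T‖ := hEo.norm_sum_mul_mul_le hEs hEo hEs id _ T
  have hnZ₁ : ‖Z₁‖ ≤ ‖T‖ := hEo.norm_sum_mul_mul_le hEs hEo hEs b _ T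
  have hnZ₂ : ‖Z₂‖ ≤ ‖T‖ := hEo.norm_sum_mul_mul_le hEs hFo hFs id _ T
  -- A column in `s` has only its diagonal block and its band besides the upper part, so `U` is `T`
  -- cut to these columns minus two block sums. The factor `1` gives the column projection the shape
  -- of a block sum.
  have hnU : ‖U‖ ≤ 3 * ‖T‖ := by
    have h1 := Finset.sum_congr rfl hs
    simp only [Finset.sum_add_distrib] at h1
    have h2 : U = T * ∑ j ∈ s, E j * 1 * E j - ∑ j ∈ s, E j * T * E j
        - ∑ j ∈ s, F j * T * E j := by
      have : ∑ j ∈ s, E j * 1 * E j = ∑ j ∈ s, E j :=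
        Finset.sum_congr rfl fun j _ => by rw [mul_one, (hEo.idem j).eq]
      rw [this, Finset.mul_sum, ← h1]
      abel
    have h3 := hEo.norm_sum_mul_mul_le hEs hEo hEs id s 1
    have h4 := hEo.norm_sum_mul_mul_le hEs hEo hEs id s T
    have h5 := hEo.norm_sum_mul_mul_le hEs hFo hFs id s T
    have h6 : ‖T * ∑ j ∈ s, E j * 1 * E j‖ ≤ ‖T‖ := by
      refine (norm_mul_le _ _).trans (mul_le_of_le_one_right (norm_nonneg _) (h3.trans ?_))
      exact ContinuousLinearMap.norm_id_le
    rw [h2]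
    refine (norm_sub_le _ _).trans ?_
    have := norm_sub_le (T * ∑ j ∈ s, E j * 1 * E j) (∑ j ∈ s, E j * T * E j)
    simp only [id] at h4 h5
    linarith
  have hnZ : ‖Z₁ + Z₂‖ ≤ 2 * ‖T‖ := (norm_add_le _ _).trans (by linarith)
  -- `G` is what remains of `T`: `7 = 1 + 1 + 3 + 2`.
  have hnG : ‖G‖ ≤ 7 * ‖T‖ := by
    have h : G = T - D - U - (Z₁ + Z₂) := by
      nth_rewrite 1 [hsum]; abel
    rw [h]
    have h1 := norm_sub_le (T - D - U) (Z₁ + Z₂)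
    have h2 := norm_sub_le (T - D) U
    have h3 := norm_sub_le T D
    linarith
  have hT0 := norm_nonneg T
  refine ⟨D, U, G, Z₁ + Z₂, hsum, ?_, sum_mem fun j _ => hupper j, sum_mem fun j hj => ?_,
    add_mem (sum_mem fun j hj => ?_) (sum_mem fun j _ => ?_), fun i => ?_, by linarith,
    by linarith, hnG, by linarith⟩
  -- `D` is `T` minus its blocks strictly above and below the diagonal, which lie in `K_V` and
  -- `K_L`, both contained in `L`. No norm control is needed here.
  · have h : D = ∑ j ∈ Finset.range n, T * E j -
        ∑ j ∈ Finset.range n, ((p j).proj * T * E j + (p (j + 1)).coproj * T * E j) := by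
      rw [← Finset.sum_sub_distrib]
      refine Finset.sum_congr rfl fun j _ => ?_
      rw [← add_mul, ← add_mul, ← sub_mul]
      congr 1
      simp only [E, coproj, sub_mul, add_mul, one_mul]
      abel
    rw [h, hsumT]
    exact sub_mem hT (sum_mem fun j _ => add_mem (hLie.KV_le hL (hupper j))
      (hLie.KL_le hL (hlower _ j j.lt_succ_self)))
  · have hj : j < b j := lt_of_le_of_ne (hjb j) (Ne.symm (Finset.mem_filter.1 hj).2)
    have h := hLie.mul_mul_sub_mem_KD (hpN (b j)) (hpN j) (hp hj.le) (hne j hj)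
      (((p (b j)).proj - E j) * T * E j)
    have hE1 : (p (b j)).proj * ((p (b j)).proj - E j) = (p (b j)).proj - E j := by
      simp [E, mul_sub, mul_proj_of_le (hp hj), mul_proj_of_le (hp hj.le)]
    have hE2 : E j * ((p (b j)).proj - (p j).proj) = E j := by
      simp [E, mul_sub, sub_mul, proj_mul_of_le (hp hj), proj_mul_of_le (hp hj.le),
        mul_proj_of_le (hp j.le_succ)]
    rw [mul_assoc, mul_assoc _ (E j), hE2, ← mul_assoc, ← mul_assoc, hE1] at h
    exact h
  · have hj : j < b j := lt_of_le_of_ne (hjb j) (Ne.symm (Finset.mem_filter.1 hj).2)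
    exact hlower' _ _ j hj (hj.trans (b j).lt_succ_self)
  · exact hlower' _ _ j (Nat.lt_succ_of_le (hjb j))
      (Nat.lt_succ_of_le (j.le_succ.trans (hjb (j + 1))))
  · rw [Finset.sum_mul, Finset.mul_sum]
    refine Finset.sum_congr rfl fun j _ => ?_
    rcases Nat.lt_or_ge j i with h | h
    · have h1 : E j * (p i).proj = E j := by
        simp [E, sub_mul, proj_mul_of_le (hp h), proj_mul_of_le (hp h.le)]
      have h2 : (p i).proj * E j = E j := by
        simp [E, mul_sub, mul_proj_of_le (hp h), mul_proj_of_le (hp h.le)]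
      rw [mul_assoc, h1, ← mul_assoc, ← mul_assoc, h2]
    · have h1 : E j * (p i).proj = 0 := by
        simp [E, sub_mul, mul_proj_of_le (hp h), mul_proj_of_le (hp (h.trans j.le_succ))]
      have h2 : (p i).proj * E j = 0 := by
        simp [E, mul_sub, proj_mul_of_le (hp h), proj_mul_of_le (hp (h.trans j.le_succ))]
      rw [mul_assoc, h1, ← mul_assoc, ← mul_assoc, h2, mul_zero, zero_mul, zero_mul]

theorem IsLieModule.exists_decomposition (hLie : N.IsLieModule L) (hL : IsWeaklyClosed L)
    (hT : T ∈ L) : ∃ D A, T = A + D ∧ A ∈ N.K L ∧ D ∈ L ∧ D ∈ N.diagonal := by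
  classical
  have hfin : ∀ s : Finset N.carrier, ∃ D U G Z : H →L[ℂ] H, T = D + U + G + Z ∧ D ∈ L ∧
      U ∈ N.KV L ∧ G ∈ N.KD L ∧ Z ∈ N.KL L ∧
      (∀ P ∈ s, D * P.1.proj = P.1.proj * D) ∧
      ‖D‖ ≤ 7 * ‖T‖ ∧ ‖U‖ ≤ 7 * ‖T‖ ∧ ‖G‖ ≤ 7 * ‖T‖ ∧ ‖Z‖ ≤ 7 * ‖T‖ := fun s => by
    obtain ⟨p, hp, hpN, h0, ⟨n, hn⟩, hps⟩ := N.exists_chain (s.image Subtype.val) fun P hP => by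
      obtain ⟨Q, -, rfl⟩ := Finset.mem_image.1 hP
      exact Q.2
    obtain ⟨D, U, G, Z, h1, h2, h3, h4, h5, h6, h7⟩ :=
      hLie.exists_decomposition_of_chain hL hp hpN h0 hn hT
    refine ⟨D, U, G, Z, h1, h2, h3, h4, h5, fun P hP => ?_, h7⟩
    obtain ⟨i, hi⟩ := hps P (Finset.mem_image_of_mem _ hP)
    exact hi ▸ h6 i
  choose D U G Z hsum hDL hU hG hZ hcomm hnD hnU hnG hnZ using hfin
  -- The ultrafilter refines `atTop`, so each `P ∈ N` eventually belongs to `s` and the limit of the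
  -- `D s` commutes with it.
  let l : Ultrafilter (Finset N.carrier) := Ultrafilter.of atTop
  obtain ⟨D', hD'⟩ := exists_weak_limit l D _ (Eventually.of_forall hnD)
  obtain ⟨U', hU'⟩ := exists_weak_limit l U _ (Eventually.of_forall hnU)
  obtain ⟨G', hG'⟩ := exists_weak_limit l G _ (Eventually.of_forall hnG)
  obtain ⟨Z', hZ'⟩ := exists_weak_limit l Z _ (Eventually.of_forall hnZ)
  refine ⟨D', U' + G' + Z', ?_, add_mem (add_mem ?_ ?_) ?_, ?_, ?_⟩
  · ext x
    refine ext_inner_left ℂ fun y => ?_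
    have h := (((hD' x y).add (hU' x y)).add (hG' x y)).add (hZ' x y)
    have h' : ∀ s, ⟪y, D s x⟫_ℂ + ⟪y, U s x⟫_ℂ + ⟪y, G s x⟫_ℂ + ⟪y, Z s x⟫_ℂ = ⟪y, T x⟫_ℂ :=
      fun s => by
        rw [← inner_add_right, ← inner_add_right, ← inner_add_right]
        exact congrArg _ (DFunLike.congr_fun (hsum s) x).symm
    simp only [h'] at h
    rw [tendsto_nhds_unique tendsto_const_nhds h]
    simp only [add_apply, inner_add_right]
    ring
  · exact N.KV_le_K L ((isWeaklyClosed_wotSpan _).mem_of_tendsto hU' (Eventually.of_forall hU))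
  · exact N.KD_le_K L ((isWeaklyClosed_wotSpan _).mem_of_tendsto hG' (Eventually.of_forall hG))
  · exact N.KL_le_K L ((isWeaklyClosed_wotSpan _).mem_of_tendsto hZ' (Eventually.of_forall hZ))
  · exact hL.mem_of_tendsto hD' (Eventually.of_forall hDL)
  · refine mem_diagonal_of_commute fun P hP => ContinuousLinearMap.ext fun x =>
      ext_inner_left ℂ fun y => ?_
    have hev : ∀ᶠ s in (l : Filter (Finset N.carrier)),
        ⟪y, D s (P.proj x)⟫_ℂ = ⟪P.proj y, D s x⟫_ℂ := by
      filter_upwards [Ultrafilter.of_le atTop (eventually_ge_atTop {⟨P, hP⟩})] with s hs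
      rw [inner_proj_left]
      exact congrArg _ (DFunLike.congr_fun (hcomm s ⟨P, hP⟩ (hs (by simp))) x)
    have := tendsto_nhds_unique_of_eventuallyEq (hD' (P.proj x) y) (hD' x (P.proj y)) hev
    rwa [inner_proj_left] at this

end CompleteNest

theorem lemma3 {H : Type*} [NormedAddCommGroup H] [InnerProductSpace ℂ H] [CompleteSpace H]
    (N : CompleteNest H) (L : Submodule ℂ (H →L[ℂ] H))
    (hclosed : IsWeaklyClosed L) (hLie : N.IsLieModule L) :
    L ≤ N.K L ⊔ Subalgebra.toSubmodule (N.DK (N.K L)) ∧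
    ∀ φ : ClosedSubmodule ℂ H → ClosedSubmodule ℂ H, N.IsAssociated (N.K L) φ →
      L ≤ N.K L ⊔ Subalgebra.toSubmodule (N.scalarDiagonal φ) := by
  refine ⟨fun T hT => ?_, fun φ hφ T hT => ?_⟩ <;>
  obtain ⟨D, A, rfl, hA, hDL, hD⟩ := hLie.exists_decomposition hclosed hT <;>
  refine Submodule.add_mem_sup hA ?_
  · exact CompleteNest.mem_scalarDiagonal (fun P _ => N.phi_mem _ P) hLie
      (fun A hA P hP x hx => hLie.apply_mem_phi (N.KV_le_K L) hA hP hx) hDL hD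
  · refine CompleteNest.mem_scalarDiagonal hφ.map_mem hLie (fun A hA P hP x hx => ?_) hDL hD
    have h := DFunLike.congr_fun ((hφ.mem_iff A).1 (N.KV_le_K L hA) P hP) x
    rw [mul_apply_eq_comp, mul_apply_eq_comp, proj_apply_eq_self_iff.2 hx] at h
    exact coproj_apply_eq_zero_iff.1 h
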